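/- Let $n\ge 1$ and let $X$ be a random vector in $\mathbb R^n$ whose law has a density $f$ with respect to Lebesgue measure, where $f:\mathbb R^n\to[0,\infty)$ is log-concave, i.e. $f(ax+by)\ge f(x)^a f(y)^b$ for all $x,y\in\mathbb R^n$ and all $a,b>0$ with $a+b=1$. Then $\mathbb E|\log f(X)|<\infty$, and $$\mathbb E\exp\Bigl\{\frac{\alpha}{\sqrt n}\,\bigl|\log f(X)-\mathbb E\log f(X)\bigr|\Bigr\}\le 3e^{4\alpha^2}\qquad\text{for all } 0\le\alpha\le\tfrac14\sqrt n .$$ -/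

import Mathlib

open MeasureTheory

/-- A nonnegative function `f` on a real vector space is log-concave if
`f (a x + b y) ≥ f x ^ a * f y ^ b` for all points `x, y` and all weights `a, b > 0` with
`a + b = 1`. Zeros of `f` are allowed: with positive exponents `0 ^ a = 0`, so the inequality is
void when `f x = 0` or `f y = 0`, and it says that `{f > 0}` is convex and that `log f` is concave
on this set. -/
structure LogConcave {E : Type*} [AddCommGroup E] [Module ℝ E] (f : E → ℝ) : Prop where
  nonneg : ∀ x, 0 ≤ f x
  rpow_mul_rpow_le : ∀ (x y : E) (a b : ℝ), 0 < a → 0 < b → a + b = 1 →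
    f x ^ a * f y ^ b ≤ f (a • x + b • y)

/-- The random vector `X : Ω → ℝⁿ` has density `f ≥ 0` with respect to Lebesgue measure: `X` and `f`
are (almost everywhere) measurable, and the law of `X` is the measure `f(x) dx`. -/
structure HasLebesgueDensity {Ω : Type*} [MeasurableSpace Ω] (P : Measure Ω) {n : ℕ}
    (X : Ω → EuclideanSpace ℝ (Fin n)) (f : EuclideanSpace ℝ (Fin n) → ℝ) : Prop where
  aemeasurable_vector : AEMeasurable X P
  aemeasurable_density : AEMeasurable f volume
  nonneg : ∀ x, 0 ≤ f x
  map_eq : P.map X = volume.withDensity (fun x => ENNReal.ofReal (f x))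

/-! Put Y = log f(X). Then E exp(tY) = ∫ f^(1+t), so everything rests on how ∫ f^s depends on s. The
perspective (x, s) ↦ f(x/s)^s is jointly log-concave, and Prékopa–Leindler lets one integrate x out:
s^n ∫ f^s is log-concave in s > 0. Since ∫ f = 1, this forces ∫ f^s < ∞ for 0 < s < 2, so Y has
exponential moments near 0 and is integrable. Moreover n log(1+t) + log E exp(tY) is concave on (-1,
1) and lies below its tangent at 0, whose slope is n + EY. Hence log E exp(t(Y - EY)) ≤ n(t -
log(1+t)) ≤ 4nt² for |t| ≤ 1/4. Adding the bounds for t = ±α/√n controls the absolute value. -/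

open scoped Pointwise ENNReal NNReal

/-! ### Prékopa–Leindler on the line -/

/-- The one-dimensional Brunn–Minkowski inequality. -/
theorem Real.volume_add_volume_le_volume_add {A B : Set ℝ} (hA : MeasurableSet A)
    (hB : MeasurableSet B) (hA' : A.Nonempty) (hB' : B.Nonempty) :
    volume A + volume B ≤ volume (A + B) := by
  have hcompact : ∀ K L : Set ℝ, IsCompact K → IsCompact L → K.Nonempty → L.Nonempty →
      volume K + volume L ≤ volume (K + L) := by
    intro K L hK hL hK' hL'
    obtain ⟨m, hmK, hm⟩ := hK.exists_isGreatest hK'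
    obtain ⟨l, hlL, hl⟩ := hL.exists_isLeast hL'
    -- With m = max K and l = min L, these two translates meet at most in the point m + l.
    have hsub : (l +ᵥ K) ∪ (m +ᵥ L) ⊆ K + L := by
      rintro z (⟨k, hk, rfl⟩ | ⟨y, hy, rfl⟩)
      · exact ⟨k, hk, l, hlL, add_comm k l⟩
      · exact ⟨m, hmK, y, hy, rfl⟩
    have hae : AEDisjoint volume (l +ᵥ K) (m +ᵥ L) := by
      refine measure_mono_null (t := {m + l}) ?_ (by simp)
      rintro z ⟨⟨k, hk, rfl⟩, ⟨y, hy, hyz⟩⟩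
      have h1 := hm hk
      have h2 := hl hy
      simp only [vadd_eq_add, Set.mem_singleton_iff] at hyz ⊢
      linarith
    calc volume K + volume L = volume (l +ᵥ K) + volume (m +ᵥ L) := by
          rw [measure_vadd, measure_vadd]
      _ = volume ((l +ᵥ K) ∪ (m +ᵥ L)) :=
          (measure_union₀ (hL.vadd m).measurableSet.nullMeasurableSet hae).symm
      _ ≤ volume (K + L) := measure_mono hsub
  obtain ⟨a₀, ha₀⟩ := hA'
  obtain ⟨b₀, hb₀⟩ := hB'
  have hsup : ∀ {s : Set ℝ}, MeasurableSet s →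
      volume s = ⨆ K : {K : Set ℝ // K ⊆ s ∧ IsCompact K}, volume (K : Set ℝ) := fun hs => by
    rw [hs.measure_eq_iSup_isCompact, iSup_subtype]
    simp only [iSup_and]
  have : Nonempty {K : Set ℝ // K ⊆ A ∧ IsCompact K} := ⟨∅, Set.empty_subset _, isCompact_empty⟩
  have : Nonempty {K : Set ℝ // K ⊆ B ∧ IsCompact K} := ⟨∅, Set.empty_subset _, isCompact_empty⟩
  rw [hsup hA, hsup hB]
  refine ENNReal.iSup_add_iSup_le fun ⟨K, hKA, hK⟩ ⟨L, hLB, hL⟩ => ?_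
  -- The inner compact sets may be empty; adding a point makes the compact case applicable.
  calc volume K + volume L ≤ volume (insert a₀ K) + volume (insert b₀ L) := by
        gcongr <;> exact Set.subset_insert _ _
    _ ≤ volume (insert a₀ K + insert b₀ L) :=
        hcompact _ _ (hK.insert a₀) (hL.insert b₀) (Set.insert_nonempty _ _)
          (Set.insert_nonempty _ _)
    _ ≤ volume (A + B) := measure_mono
        (Set.add_subset_add (Set.insert_subset ha₀ hKA) (Set.insert_subset hb₀ hLB))

/-- The additive form of the one-dimensional Prékopa–Leindler inequality, for functions of
supremum one. -/
theorem lintegral_add_le_of_rpow_mul_rpow_le {f g h : ℝ → ℝ} {a b : ℝ} (ha : 0 < a) (hb : 0 < b)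
    (hab : a + b = 1) (hf : Measurable f) (hg : Measurable g) (hh : Measurable h)
    (hf0 : ∀ x, 0 ≤ f x) (hg0 : ∀ x, 0 ≤ g x) (hh0 : ∀ x, 0 ≤ h x)
    (hf1 : ∀ x, f x ≤ 1) (hg1 : ∀ x, g x ≤ 1)
    (hf1' : ∀ t < 1, ∃ x, t < f x) (hg1' : ∀ t < 1, ∃ x, t < g x)
    (hfg : ∀ x y, f x ^ a * g y ^ b ≤ h (a * x + b * y)) :
    ENNReal.ofReal a * (∫⁻ x, ENNReal.ofReal (f x)) +
      ENNReal.ofReal b * (∫⁻ x, ENNReal.ofReal (g x)) ≤ ∫⁻ x, ENNReal.ofReal (h x) := by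
  rw [lintegral_eq_lintegral_meas_lt volume (.of_forall hf0) hf.aemeasurable,
    lintegral_eq_lintegral_meas_lt volume (.of_forall hg0) hg.aemeasurable,
    lintegral_eq_lintegral_meas_lt volume (.of_forall hh0) hh.aemeasurable]
  refine (add_le_add (lintegral_const_mul_le _ _) (lintegral_const_mul_le _ _)).trans
    ((le_lintegral_add _ _).trans (setLIntegral_mono' measurableSet_Ioi fun t ht => ?_))
  rcases lt_or_ge t 1 with ht1 | ht1
  -- For t < 1 both superlevel sets are nonempty and a{f > t} + b{g > t} ⊆ {h > t}, so
  -- Brunn–Minkowski applies level by level. For t ≥ 1 the left side vanishes.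
  · have hscale : ∀ c : ℝ, 0 < c → ∀ s : Set ℝ,
        ENNReal.ofReal c * volume s = volume (c • s) := fun c hc s => by
      simp [Measure.addHaar_smul, abs_of_pos hc]
    rw [hscale a ha, hscale b hb]
    refine (Real.volume_add_volume_le_volume_add
      ((measurableSet_lt measurable_const hf).const_smul₀ a)
      ((measurableSet_lt measurable_const hg).const_smul₀ b)
      (Set.Nonempty.smul_set (hf1' t ht1)) (Set.Nonempty.smul_set (hg1' t ht1))).trans
      (measure_mono ?_)
    rintro _ ⟨_, ⟨x, hx, rfl⟩, _, ⟨y, hy, rfl⟩, rfl⟩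
    have ht0 : 0 < t := ht
    refine lt_of_lt_of_le ?_ (hfg x y)
    calc t = t ^ a * t ^ b := by rw [← Real.rpow_add ht0, hab, Real.rpow_one]
      _ < f x ^ a * g y ^ b :=
        mul_lt_mul'' (Real.rpow_lt_rpow ht0.le hx ha) (Real.rpow_lt_rpow ht0.le hy hb)
          (by positivity) (by positivity)
  · have h1 : {x | t < f x} = ∅ := by
      ext x; simpa using (hf1 x).trans ht1
    have h2 : {x | t < g x} = ∅ := by
      ext x; simpa using (hg1 x).trans ht1
    simp [h1, h2]

/-- The Prékopa–Leindler inequality, as a property of a measure on a real vector space. -/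
def PrekopaLeindler {E : Type*} [AddCommGroup E] [Module ℝ E] [MeasurableSpace E]
    (μ : Measure E) : Prop :=
  ∀ ⦃f g h : E → ℝ≥0∞⦄ ⦃a b : ℝ⦄, Measurable f → Measurable g → Measurable h →
    0 < a → 0 < b → a + b = 1 → (∀ x y, f x ^ a * g y ^ b ≤ h (a • x + b • y)) →
    (∫⁻ x, f x ∂μ) ^ a * (∫⁻ x, g x ∂μ) ^ b ≤ ∫⁻ x, h x ∂μ

theorem ENNReal.rpow_mul_rpow_le_add {a b : ℝ} (ha : 0 < a) (hb : 0 < b) (hab : a + b = 1)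
    (u v : ℝ≥0∞) : u ^ a * v ^ b ≤ ENNReal.ofReal a * u + ENNReal.ofReal b * v := by
  have hpq : (a⁻¹).HolderConjugate b⁻¹ := by
    rw [Real.holderConjugate_iff]
    refine ⟨(one_lt_inv₀ ha).2 (by linarith), by simpa using hab⟩
  refine (ENNReal.young_inequality (u ^ a) (v ^ b) hpq).trans (le_of_eq ?_)
  rw [← ENNReal.rpow_mul, ← ENNReal.rpow_mul, mul_inv_cancel₀ ha.ne', mul_inv_cancel₀ hb.ne',
    ENNReal.rpow_one, ENNReal.rpow_one, ENNReal.ofReal_inv_of_pos ha, ENNReal.ofReal_inv_of_pos hb,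
    div_eq_mul_inv, div_eq_mul_inv, inv_inv, inv_inv, mul_comm, mul_comm v]

/-- Dividing f, g, h by A, B, A^a B^b gives f and g supremum one; the additive form and weighted
AM–GM then yield the product form. -/
theorem lintegral_rpow_mul_rpow_le_of_iSup_ne_top {f g h : ℝ → ℝ≥0∞} {a b : ℝ}
    (hf : Measurable f) (hg : Measurable g) (hh : Measurable h)
    (ha : 0 < a) (hb : 0 < b) (hab : a + b = 1)
    (hfg : ∀ x y, f x ^ a * g y ^ b ≤ h (a • x + b • y))
    (hftop : ⨆ x, f x ≠ ∞) (hgtop : ⨆ x, g x ≠ ∞) :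
    (∫⁻ x, f x) ^ a * (∫⁻ x, g x) ^ b ≤ ∫⁻ x, h x := by
  set A := ⨆ x, f x with hA
  set B := ⨆ x, g x with hB
  have hfA : ∀ x, f x ≤ A := le_iSup f
  have hgB : ∀ x, g x ≤ B := le_iSup g
  rcases eq_or_ne A 0 with hA0 | hA0
  · have : ∀ x, f x = 0 := fun x => le_zero_iff.1 (hA0 ▸ hfA x)
    simp [this, ha]
  rcases eq_or_ne B 0 with hB0 | hB0
  · have : ∀ x, g x = 0 := fun x => le_zero_iff.1 (hB0 ▸ hgB x)
    simp [this, hb]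
  have hnorm : ∀ {u : ℝ → ℝ≥0∞} {M : ℝ≥0∞}, Measurable u → M = ⨆ x, u x → M ≠ ∞ → M ≠ 0 →
      (∀ x, ENNReal.ofReal (u x / M).toReal = u x / M) ∧ (∀ x, (u x / M).toReal ≤ 1) ∧
      (∀ t < 1, ∃ x, t < (u x / M).toReal) ∧ Measurable (fun x => (u x / M).toReal) ∧
      ∫⁻ x, u x = M * ∫⁻ x, ENNReal.ofReal (u x / M).toReal := by
    intro u M hu hM hMtop hM0
    have hle : ∀ x, u x / M ≤ 1 := fun x =>
      ENNReal.div_le_of_le_mul (by simpa [hM] using le_iSup u x)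
    have hfin : ∀ x, ENNReal.ofReal (u x / M).toReal = u x / M := fun x =>
      ENNReal.ofReal_toReal (ne_top_of_le_ne_top ENNReal.one_ne_top (hle x))
    refine ⟨hfin, fun x => ENNReal.toReal_le_of_le_ofReal zero_le_one (by simpa using hle x),
      fun t ht => ?_, (hu.div_const M).ennreal_toReal, ?_⟩
    · have : ENNReal.ofReal t * M < ⨆ x, u x := by
        rw [← hM]
        conv_rhs => rw [← one_mul M]
        exact ENNReal.mul_lt_mul_left hM0 hMtop (by simpa using ht)
      obtain ⟨x, hx⟩ := lt_iSup_iff.1 this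
      refine ⟨x, ?_⟩
      have h1 : ENNReal.ofReal t < u x / M :=
        (ENNReal.lt_div_iff_mul_lt (Or.inl hM0) (Or.inl hMtop)).2 hx
      rw [← hfin] at h1
      exact (ENNReal.ofReal_lt_ofReal_iff'.1 h1).1
    · simp_rw [hfin]
      rw [← lintegral_const_mul _ (hu.div_const M)]
      exact lintegral_congr fun x => (ENNReal.mul_div_cancel hM0 hMtop).symm
  obtain ⟨hf2, hf1, hf1', hfm, hfI⟩ := hnorm hf hA hftop hA0
  obtain ⟨hg2, hg1, hg1', hgm, hgI⟩ := hnorm hg hB hgtop hB0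
  set C := A ^ a * B ^ b with hC
  have hC0 : C ≠ 0 := mul_ne_zero (by simp [hA0, hftop]) (by simp [hB0, hgtop])
  have hCtop : C ≠ ∞ := ENNReal.mul_ne_top (ENNReal.rpow_ne_top_of_nonneg ha.le hftop)
    (ENNReal.rpow_ne_top_of_nonneg hb.le hgtop)
  -- Capping at 1 makes h finite, and costs nothing because the normalised f and g are at most 1.
  have hhm : Measurable fun x => min (h x / C) 1 := (hh.div_const C).min measurable_const
  have hh1 : ∀ x, ENNReal.ofReal (min (h x / C) 1).toReal = min (h x / C) 1 := fun x =>
    ENNReal.ofReal_toReal (ne_top_of_le_ne_top ENNReal.one_ne_top (min_le_right _ _))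
  have key := lintegral_add_le_of_rpow_mul_rpow_le ha hb hab hfm hgm hhm.ennreal_toReal
    (fun _ => ENNReal.toReal_nonneg) (fun _ => ENNReal.toReal_nonneg)
    (fun _ => ENNReal.toReal_nonneg) hf1 hg1 hf1' hg1' fun x y => by
      rw [ENNReal.toReal_rpow, ENNReal.toReal_rpow, ← ENNReal.toReal_mul]
      refine ENNReal.toReal_mono (ne_top_of_le_ne_top ENNReal.one_ne_top (min_le_right _ _))
        (le_min ?_ ?_)
      · rw [ENNReal.div_rpow_of_nonneg _ _ ha.le, ENNReal.div_rpow_of_nonneg _ _ hb.le,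
          ENNReal.le_div_iff_mul_le (Or.inl hC0) (Or.inl hCtop)]
        refine le_trans (le_of_eq ?_) (hfg x y)
        rw [hC, mul_mul_mul_comm, ENNReal.div_mul_cancel, ENNReal.div_mul_cancel]
        all_goals simp [hA0, hB0, hftop, hgtop]
      · refine mul_le_one' (ENNReal.rpow_le_one ?_ ha.le) (ENNReal.rpow_le_one ?_ hb.le)
        · exact ENNReal.div_le_of_le_mul (by simpa using hfA x)
        · exact ENNReal.div_le_of_le_mul (by simpa using hgB y)
  calc (∫⁻ x, f x) ^ a * (∫⁻ x, g x) ^ b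
      = C * ((∫⁻ x, ENNReal.ofReal (f x / A).toReal) ^ a *
          (∫⁻ x, ENNReal.ofReal (g x / B).toReal) ^ b) := by
        rw [hfI, hgI, ENNReal.mul_rpow_of_nonneg _ _ ha.le, ENNReal.mul_rpow_of_nonneg _ _ hb.le,
          mul_mul_mul_comm]
    _ ≤ C * ∫⁻ x, h x / C := by
        gcongr
        refine (ENNReal.rpow_mul_rpow_le_add ha hb hab _ _).trans (key.trans ?_)
        exact lintegral_mono fun x => (hh1 x).trans_le (min_le_left _ _)
    _ = ∫⁻ x, h x := by
        rw [← lintegral_const_mul _ (hh.div_const C)]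
        exact lintegral_congr fun x => ENNReal.mul_div_cancel hC0 hCtop

theorem prekopaLeindler_real : PrekopaLeindler (volume : Measure ℝ) := by
  intro f g h a b hf hg hh ha hb hab hfg
  have hlim : ∀ f : ℝ → ℝ≥0∞, Measurable f → Filter.Tendsto (fun N : ℕ => ∫⁻ x, min (f x) N)
      Filter.atTop (nhds (∫⁻ x, f x)) := by
    intro f hf
    refine lintegral_tendsto_of_tendsto_of_monotone
      (fun N => (hf.min measurable_const).aemeasurable) ?_ ?_
    · exact .of_forall fun x M N hMN => min_le_min_left _ (by exact_mod_cast hMN)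
    · refine .of_forall fun x => ?_
      simpa using tendsto_const_nhds.min ENNReal.tendsto_nat_nhds_top
  -- Multiplication on `ℝ≥0∞` is discontinuous at (0, ∞), so zero integrals are removed before
  -- passing to the limit in the truncations.
  rcases eq_or_ne (∫⁻ x, f x) 0 with hf0 | hf0
  · simp [hf0, ha]
  rcases eq_or_ne (∫⁻ x, g x) 0 with hg0 | hg0
  · simp [hg0, hb]
  refine le_of_tendsto (ENNReal.Tendsto.mul ((hlim f hf).ennrpow_const a) (Or.inl ?_)
    ((hlim g hg).ennrpow_const b) (Or.inl ?_)) (.of_forall fun N => ?_)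
  · simp [hf0, ha.not_gt]
  · simp [hg0, hb.not_gt]
  refine lintegral_rpow_mul_rpow_le_of_iSup_ne_top (hf.min measurable_const)
    (hg.min measurable_const) hh ha hb hab (fun x y => (hfg x y).trans' ?_) ?_ ?_
  · gcongr <;> exact min_le_left _ _
  · exact ne_top_of_le_ne_top (ENNReal.natCast_ne_top N) (iSup_le fun x => min_le_right _ _)
  · exact ne_top_of_le_ne_top (ENNReal.natCast_ne_top N) (iSup_le fun x => min_le_right _ _)

/-! ### Tensorisation to ℝⁿ -/

theorem PrekopaLeindler.prod {E F : Type*} [AddCommGroup E] [Module ℝ E] [MeasurableSpace E]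
    [AddCommGroup F] [Module ℝ F] [MeasurableSpace F] {μ : Measure E} {ν : Measure F}
    [SFinite ν] (hμ : PrekopaLeindler μ) (hν : PrekopaLeindler ν) :
    PrekopaLeindler (μ.prod ν) := by
  intro f g h a b hf hg hh ha hb hab hfg
  rw [lintegral_prod _ hf.aemeasurable, lintegral_prod _ hg.aemeasurable,
    lintegral_prod _ hh.aemeasurable]
  refine hμ hf.lintegral_prod_right' hg.lintegral_prod_right' hh.lintegral_prod_right' ha hb hab
    fun x y => ?_
  exact hν (hf.comp measurable_prodMk_left) (hg.comp measurable_prodMk_left)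
    (hh.comp measurable_prodMk_left) ha hb hab fun z w => hfg (x, z) (y, w)

theorem PrekopaLeindler.of_measurePreserving {E F : Type*} [AddCommGroup E] [Module ℝ E]
    [MeasurableSpace E] [AddCommGroup F] [Module ℝ F] [MeasurableSpace F] {μ : Measure E}
    {ν : Measure F} (hμ : PrekopaLeindler μ) (e : E →ₗ[ℝ] F) (he : MeasurePreserving e μ ν) :
    PrekopaLeindler ν := by
  intro f g h a b hf hg hh ha hb hab hfg
  rw [← he.lintegral_comp hf, ← he.lintegral_comp hg, ← he.lintegral_comp hh]
  refine hμ (hf.comp he.measurable) (hg.comp he.measurable) (hh.comp he.measurable) ha hb hab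
    fun x y => ?_
  simpa using hfg (e x) (e y)

theorem prekopaLeindler_pi (n : ℕ) : PrekopaLeindler (volume : Measure (Fin n → ℝ)) := by
  induction n with
  | zero =>
    intro f g h a b hf hg hh ha hb hab hfg
    rw [Measure.volume_pi_eq_dirac 0, lintegral_dirac, lintegral_dirac, lintegral_dirac]
    exact (hfg 0 0).trans_eq (congrArg h (Subsingleton.elim _ _))
  | succ n ih =>
    have he := (volume_preserving_piFinSuccAbove (fun _ : Fin (n + 1) => ℝ) 0).symm
    refine (prekopaLeindler_real.prod ih).of_measurePreserving
      (Fin.consLinearEquiv ℝ (fun _ => ℝ)).toLinearMap ?_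
    have hcoe : ⇑(Fin.consLinearEquiv ℝ (fun _ : Fin (n + 1) => ℝ)).toLinearMap =
        ⇑(MeasurableEquiv.piFinSuccAbove (fun _ : Fin (n + 1) => ℝ) 0).symm := by
      funext p
      exact (Fin.insertNth_zero' p.1 p.2).symm
    rw [hcoe]
    exact he

theorem prekopaLeindler_euclideanSpace (n : ℕ) :
    PrekopaLeindler (volume : Measure (EuclideanSpace ℝ (Fin n))) :=
  (prekopaLeindler_pi n).of_measurePreserving
    (WithLp.linearEquiv 2 ℝ (Fin n → ℝ)).symm.toLinearMap (PiLp.volume_preserving_toLp (Fin n))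

/-! ### Log-concave functions and their power integrals -/

namespace LogConcave

section Measurability

variable {E : Type*} [NormedAddCommGroup E] [NormedSpace ℝ E] {f : E → ℝ}

theorem convex_support (hf : LogConcave f) : Convex ℝ {x | 0 < f x} := by
  rw [convex_iff_forall_pos]
  intro x hx y hy a b ha hb hab
  exact (mul_pos (Real.rpow_pos_of_pos hx a) (Real.rpow_pos_of_pos hy b)).trans_le
    (hf.rpow_mul_rpow_le x y a b ha hb hab)

theorem concaveOn_log (hf : LogConcave f) : ConcaveOn ℝ {x | 0 < f x} fun x => Real.log (f x) := by
  refine concaveOn_iff_forall_pos.2 ⟨hf.convex_support, ?_⟩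
  intro x hx y hy a b ha hb hab
  have hx' : 0 < f x := hx
  have hy' : 0 < f y := hy
  have h := Real.log_le_log (by positivity) (hf.rpow_mul_rpow_le x y a b ha hb hab)
  rwa [Real.log_mul (by positivity) (by positivity), Real.log_rpow hx', Real.log_rpow hy'] at h

/-- A log-concave f may fail to be Borel on the boundary of its support. Cutting to the interior
gives a Borel version, equal to f a.e. because the frontier of a convex set is null. -/
theorem indicator_interior (hf : LogConcave f) :
    LogConcave ((interior {x | 0 < f x}).indicator f) := by
  refine ⟨fun x => Set.indicator_nonneg (fun y _ => hf.nonneg y) x, fun x y a b ha hb hab => ?_⟩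
  by_cases hx : x ∈ interior {x | 0 < f x}
  · by_cases hy : y ∈ interior {x | 0 < f x}
    · rw [Set.indicator_of_mem hx, Set.indicator_of_mem hy, Set.indicator_of_mem
        (hf.convex_support.interior hx hy ha.le hb.le hab)]
      exact hf.rpow_mul_rpow_le x y a b ha hb hab
    · rw [Set.indicator_of_notMem hy, Real.zero_rpow hb.ne', mul_zero]
      exact Set.indicator_nonneg (fun y _ => hf.nonneg y) _
  · rw [Set.indicator_of_notMem hx, Real.zero_rpow ha.ne', zero_mul]
    exact Set.indicator_nonneg (fun y _ => hf.nonneg y) _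

variable [FiniteDimensional ℝ E] [MeasurableSpace E] [BorelSpace E]

theorem measurable_indicator_interior (hf : LogConcave f) :
    Measurable ((interior {x | 0 < f x}).indicator f) := by
  classical
  have hcont : ContinuousOn f (interior {x | 0 < f x}) :=
    (hf.concaveOn_log.continuousOn_interior.rexp).congr fun x hx =>
      (Real.exp_log (interior_subset hx : x ∈ {x | 0 < f x})).symm
  rw [← Set.piecewise_eq_indicator]
  exact hcont.measurable_piecewise continuousOn_const isOpen_interior.measurableSet

theorem indicator_interior_ae_eq (hf : LogConcave f) (μ : Measure E) [μ.IsAddHaarMeasure] :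
    (interior {x | 0 < f x}).indicator f =ᵐ[μ] f := by
  have h := measure_eq_zero_iff_ae_notMem.1 (hf.convex_support.addHaar_frontier μ)
  filter_upwards [h] with x hx
  by_cases hxi : x ∈ interior {x | 0 < f x}
  · exact Set.indicator_of_mem hxi f
  · rw [Set.indicator_of_notMem hxi]
    refine le_antisymm (hf.nonneg x) (not_lt.1 fun hpos => hx ⟨subset_closure hpos, hxi⟩)

end Measurability

section Perspective

variable {E : Type*} [AddCommGroup E] [Module ℝ E] {f : E → ℝ}

/-- The perspective `(x, t) ↦ f (x / t) ^ t` of a log-concave function is log-concave. -/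
theorem perspective (hf : LogConcave f) {s u a b : ℝ} (hs : 0 < s) (hu : 0 < u) (ha : 0 < a)
    (hb : 0 < b) (x y : E) :
    (f (s⁻¹ • x) ^ s) ^ a * (f (u⁻¹ • y) ^ u) ^ b ≤
      f ((a * s + b * u)⁻¹ • (a • x + b • y)) ^ (a * s + b * u) := by
  set t := a * s + b * u with ht
  have ht0 : 0 < t := by positivity
  -- These weights make the convex combination of x/s and y/u equal to (ax + by)/t; raising to the
  -- power t then clears the denominators.
  have h := hf.rpow_mul_rpow_le (s⁻¹ • x) (u⁻¹ • y) (a * s / t) (b * u / t) (by positivity)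
    (by positivity) (by rw [← add_div, ← ht, div_self ht0.ne'])
  have harg : (a * s / t) • s⁻¹ • x + (b * u / t) • u⁻¹ • y = t⁻¹ • (a • x + b • y) := by
    rw [smul_add, smul_smul, smul_smul, smul_smul, smul_smul]
    congr 2 <;> field_simp
  rw [harg] at h
  have h2 := Real.rpow_le_rpow (mul_nonneg (Real.rpow_nonneg (hf.nonneg _) _)
    (Real.rpow_nonneg (hf.nonneg _) _)) h ht0.le
  rw [Real.mul_rpow (Real.rpow_nonneg (hf.nonneg _) _) (Real.rpow_nonneg (hf.nonneg _) _),
    ← Real.rpow_mul (hf.nonneg _), ← Real.rpow_mul (hf.nonneg _), div_mul_cancel₀ _ ht0.ne',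
    div_mul_cancel₀ _ ht0.ne'] at h2
  rwa [← Real.rpow_mul (hf.nonneg _), ← Real.rpow_mul (hf.nonneg _), mul_comm s, mul_comm u]

end Perspective

variable {n : ℕ} {f : EuclideanSpace ℝ (Fin n) → ℝ}

/-- The function `t ↦ t ^ n * ∫ f ^ t` is log-concave on the positive half-line. -/
theorem pow_mul_lintegral_rpow (hf : LogConcave f) {s u a b : ℝ} (hs : 0 < s) (hu : 0 < u)
    (ha : 0 < a) (hb : 0 < b) (hab : a + b = 1) :
    (ENNReal.ofReal (s ^ n) * ∫⁻ x, ENNReal.ofReal (f x ^ s)) ^ a *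
      (ENNReal.ofReal (u ^ n) * ∫⁻ x, ENNReal.ofReal (f x ^ u)) ^ b ≤
    ENNReal.ofReal ((a * s + b * u) ^ n) * ∫⁻ x, ENNReal.ofReal (f x ^ (a * s + b * u)) := by
  set g := (interior {x | 0 < f x}).indicator f with hg_def
  have hg : LogConcave g := hf.indicator_interior
  have hgm : Measurable g := hf.measurable_indicator_interior
  have hgf : g =ᵐ[volume] f := hf.indicator_interior_ae_eq volume
  have hI : ∀ t : ℝ, 0 < t → ENNReal.ofReal (t ^ n) * (∫⁻ x, ENNReal.ofReal (f x ^ t)) =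
      ∫⁻ x, ENNReal.ofReal (g (t⁻¹ • x) ^ t) := by
    intro t ht
    have hm : Measurable fun x => ENNReal.ofReal (g x ^ t) :=
      (hgm.pow_const t).ennreal_ofReal
    rw [← lintegral_map (f := fun x => ENNReal.ofReal (g x ^ t)) hm (measurable_const_smul t⁻¹),
      Measure.map_addHaar_smul _ (inv_ne_zero ht.ne'), lintegral_smul_measure]
    simp only [finrank_euclideanSpace, Fintype.card_fin, inv_pow, inv_inv, smul_eq_mul,
      abs_of_pos (pow_pos ht n)]
    congr 1
    refine lintegral_congr_ae ?_
    filter_upwards [hgf] with x hx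
    rw [hx]
  rw [hI s hs, hI u hu, hI _ (by positivity)]
  refine prekopaLeindler_euclideanSpace n ?_ ?_ ?_ ha hb hab fun x y => ?_
  iterate 3
    exact ((hgm.comp (measurable_const_smul _)).pow_const _).ennreal_ofReal
  rw [ENNReal.ofReal_rpow_of_nonneg (Real.rpow_nonneg (hg.nonneg _) _) ha.le,
    ENNReal.ofReal_rpow_of_nonneg (Real.rpow_nonneg (hg.nonneg _) _) hb.le,
    ← ENNReal.ofReal_mul (Real.rpow_nonneg (Real.rpow_nonneg (hg.nonneg _) _) _)]
  exact ENNReal.ofReal_le_ofReal (hg.perspective hs hu ha hb x y)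

end LogConcave

/-! ### Exponential moments of log f(X) -/

namespace HasLebesgueDensity

variable {Ω : Type*} [MeasurableSpace Ω] {P : Measure Ω} {n : ℕ}
  {X : Ω → EuclideanSpace ℝ (Fin n)} {f : EuclideanSpace ℝ (Fin n) → ℝ}

theorem aemeasurable_log_comp (hX : HasLebesgueDensity P X f) :
    AEMeasurable (fun ω => Real.log (f (X ω))) P := by
  have hac : P.map X ≪ volume := hX.map_eq ▸ withDensity_absolutelyContinuous _ _
  exact ((hX.aemeasurable_density.mono_ac hac).comp_aemeasurable hX.aemeasurable_vector).log

theorem lintegral_exp_mul_log (hX : HasLebesgueDensity P X f) {t : ℝ} (ht : -1 < t) :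
    ∫⁻ ω, ENNReal.ofReal (Real.exp (t * Real.log (f (X ω)))) ∂P =
      ∫⁻ x, ENNReal.ofReal (f x ^ (1 + t)) := by
  have hac : P.map X ≪ volume := hX.map_eq ▸ withDensity_absolutelyContinuous _ _
  have hm : AEMeasurable (fun x => ENNReal.ofReal (Real.exp (t * Real.log (f x)))) volume :=
    (hX.aemeasurable_density.log.const_mul t).exp.ennreal_ofReal
  rw [← lintegral_map' (f := fun x => ENNReal.ofReal (Real.exp (t * Real.log (f x))))
    (hm.mono_ac hac) hX.aemeasurable_vector, hX.map_eq,
    lintegral_withDensity_eq_lintegral_mul₀ hX.aemeasurable_density.ennreal_ofReal hm]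
  refine lintegral_congr fun x => ?_
  rw [Pi.mul_apply, ← ENNReal.ofReal_mul (hX.nonneg x)]
  rcases (hX.nonneg x).eq_or_lt with h | h
  -- Where f = 0 the density kills the junk value log 0 = 0, and 1 + t > 0 makes the right side
  -- vanish too.
  · rw [← h, Real.zero_rpow (by linarith), zero_mul]
  · rw [Real.rpow_add h, Real.rpow_one, mul_comm t, ← Real.rpow_def_of_pos h]

theorem lintegral_density [IsProbabilityMeasure P] (hX : HasLebesgueDensity P X f) :
    ∫⁻ x, ENNReal.ofReal (f x) = 1 := by
  simpa using (hX.lintegral_exp_mul_log (t := 0) (by norm_num)).symm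

theorem lintegral_rpow_ne_zero [IsProbabilityMeasure P] (hX : HasLebesgueDensity P X f) (t : ℝ) :
    ∫⁻ x, ENNReal.ofReal (f x ^ t) ≠ 0 := by
  intro h
  rw [lintegral_eq_zero_iff' (hX.aemeasurable_density.pow_const t).ennreal_ofReal] at h
  have h1 : ∫⁻ x, ENNReal.ofReal (f x) = 0 := by
    rw [lintegral_eq_zero_iff' hX.aemeasurable_density.ennreal_ofReal]
    filter_upwards [h] with x hx
    have : f x ^ t ≤ 0 := ENNReal.ofReal_eq_zero.1 hx
    exact ENNReal.ofReal_eq_zero.2 (not_lt.1 fun hpos =>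
      (Real.rpow_pos_of_pos hpos t).not_ge this)
  simp [hX.lintegral_density] at h1

/-- Since 1 is the midpoint of t and 2 - t, an infinite integral at t, paired with a nonzero one at
2 - t, would force ∫ f = ∞. -/
theorem lintegral_rpow_ne_top [IsProbabilityMeasure P] (hX : HasLebesgueDensity P X f)
    (hf : LogConcave f) {t : ℝ} (ht0 : 0 < t) (ht2 : t < 2) :
    ∫⁻ x, ENNReal.ofReal (f x ^ t) ≠ ∞ := by
  intro h
  have hu : 0 < 2 - t := by linarith
  have key := hf.pow_mul_lintegral_rpow ht0 hu (a := 1 / 2) (b := 1 / 2) (by norm_num)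
    (by norm_num) (by norm_num)
  have h1 : 1 / 2 * t + 1 / 2 * (2 - t) = 1 := by ring
  have h2 : (ENNReal.ofReal ((2 - t) ^ n) *
      ∫⁻ x, ENNReal.ofReal (f x ^ (2 - t))) ^ (1 / 2 : ℝ) ≠ 0 := by
    rw [Ne, ENNReal.rpow_eq_zero_iff_of_pos (by norm_num)]
    exact mul_ne_zero (by simpa using pow_pos hu n) (hX.lintegral_rpow_ne_zero _)
  rw [h1, h, ENNReal.mul_top (by simpa using pow_pos ht0 n),
    ENNReal.top_rpow_of_pos (by norm_num), ENNReal.top_mul h2] at key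
  simp [hX.lintegral_density] at key

end HasLebesgueDensity

/-! ### Concavity and the tangent bound for the log-mgf -/

open ProbabilityTheory

namespace HasLebesgueDensity

variable {Ω : Type*} [MeasurableSpace Ω] {P : Measure Ω} {n : ℕ}
  {X : Ω → EuclideanSpace ℝ (Fin n)} {f : EuclideanSpace ℝ (Fin n) → ℝ}

theorem mgf_log (hX : HasLebesgueDensity P X f) {t : ℝ} (ht : -1 < t) :
    mgf (fun ω => Real.log (f (X ω))) P t = (∫⁻ x, ENNReal.ofReal (f x ^ (1 + t))).toReal := by
  rw [mgf, integral_eq_lintegral_of_nonneg_ae (.of_forall fun _ => (Real.exp_pos _).le)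
    (hX.aemeasurable_log_comp.const_mul t).exp.aestronglyMeasurable, hX.lintegral_exp_mul_log ht]

variable [IsProbabilityMeasure P]

theorem Ioo_subset_integrableExpSet (hX : HasLebesgueDensity P X f) (hf : LogConcave f) :
    Set.Ioo (-1) 1 ⊆ integrableExpSet (fun ω => Real.log (f (X ω))) P := by
  intro t ht
  refine ⟨(hX.aemeasurable_log_comp.const_mul t).exp.aestronglyMeasurable, ?_⟩
  rw [hasFiniteIntegral_iff_ofReal (.of_forall fun _ => (Real.exp_pos _).le),
    hX.lintegral_exp_mul_log ht.1]
  exact (hX.lintegral_rpow_ne_top hf (by linarith [ht.1]) (by linarith [ht.2])).lt_top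

theorem concaveOn_log_mgf (hX : HasLebesgueDensity P X f) (hf : LogConcave f) :
    ConcaveOn ℝ (Set.Ioo (-1) 1) fun t =>
      n * Real.log (1 + t) + Real.log (mgf (fun ω => Real.log (f (X ω))) P t) := by
  refine concaveOn_iff_forall_pos.2 ⟨convex_Ioo _ _, ?_⟩
  intro s hs u hu a b ha hb hab
  set M := mgf (fun ω => Real.log (f (X ω))) P with hM
  have hmem : a • s + b • u ∈ Set.Ioo (-1 : ℝ) 1 := convex_Ioo _ _ hs hu ha.le hb.le hab
  have hpos : ∀ t ∈ Set.Ioo (-1 : ℝ) 1, 0 < M t := fun t ht =>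
    mgf_pos (hX.Ioo_subset_integrableExpSet hf ht)
  have hprod : ∀ t ∈ Set.Ioo (-1 : ℝ) 1, ENNReal.ofReal ((1 + t) ^ n) *
      (∫⁻ x, ENNReal.ofReal (f x ^ (1 + t))) = ENNReal.ofReal ((1 + t) ^ n * M t) := by
    intro t ht
    rw [ENNReal.ofReal_mul (pow_nonneg (by linarith [ht.1]) n), hM, hX.mgf_log ht.1,
      ENNReal.ofReal_toReal
        (hX.lintegral_rpow_ne_top hf (by linarith [ht.1]) (by linarith [ht.2]))]
  have hval : ∀ t ∈ Set.Ioo (-1 : ℝ) 1, 0 < (1 + t) ^ n * M t := fun t ht =>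
    mul_pos (pow_pos (by linarith [ht.1]) n) (hpos t ht)
  have hlog : ∀ t ∈ Set.Ioo (-1 : ℝ) 1,
      n * Real.log (1 + t) + Real.log (M t) = Real.log ((1 + t) ^ n * M t) := by
    intro t ht
    have : 0 < 1 + t := by linarith [ht.1]
    rw [Real.log_mul (pow_pos this n).ne' (hpos t ht).ne', Real.log_pow]
  have key := hf.pow_mul_lintegral_rpow (s := 1 + s) (u := 1 + u) (by linarith [hs.1])
    (by linarith [hu.1]) ha hb hab
  have harg : a * (1 + s) + b * (1 + u) = 1 + (a • s + b • u) := by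
    simp only [smul_eq_mul]; linear_combination hab
  rw [harg, hprod s hs, hprod u hu, hprod _ hmem,
    ENNReal.ofReal_rpow_of_pos (hval s hs), ENNReal.ofReal_rpow_of_pos (hval u hu),
    ← ENNReal.ofReal_mul (Real.rpow_nonneg (hval s hs).le a),
    ENNReal.ofReal_le_ofReal_iff (hval _ hmem).le] at key
  have h := Real.log_le_log (mul_pos (Real.rpow_pos_of_pos (hval s hs) a)
    (Real.rpow_pos_of_pos (hval u hu) b)) key
  rw [Real.log_mul (Real.rpow_pos_of_pos (hval s hs) a).ne'
    (Real.rpow_pos_of_pos (hval u hu) b).ne', Real.log_rpow (hval s hs),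
    Real.log_rpow (hval u hu)] at h
  rw [← hlog s hs, ← hlog u hu, ← hlog _ hmem] at h
  exact h

theorem zero_mem_interior_integrableExpSet (hX : HasLebesgueDensity P X f) (hf : LogConcave f) :
    (0 : ℝ) ∈ interior (integrableExpSet (fun ω => Real.log (f (X ω))) P) :=
  interior_maximal (hX.Ioo_subset_integrableExpSet hf) isOpen_Ioo (by norm_num)

theorem integrable_log (hX : HasLebesgueDensity P X f) (hf : LogConcave f) :
    Integrable (fun ω => Real.log (f (X ω))) P :=
  integrable_of_mem_interior_integrableExpSet (hX.zero_mem_interior_integrableExpSet hf)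

/-- The logarithmic moment generating function of the centred variable `log f(X)` is at most
`n (t - log (1 + t))`. -/
theorem log_mgf_le (hX : HasLebesgueDensity P X f) (hf : LogConcave f) {t : ℝ}
    (ht : t ∈ Set.Ioo (-1) 1) :
    n * Real.log (1 + t) + Real.log (mgf (fun ω => Real.log (f (X ω))) P t) ≤
      (n + ∫ ω, Real.log (f (X ω)) ∂P) * t := by
  have hc := hX.concaveOn_log_mgf hf
  have hd : HasDerivAt (fun t => n * Real.log (1 + t) +
      Real.log (mgf (fun ω => Real.log (f (X ω))) P t)) (n + ∫ ω, Real.log (f (X ω)) ∂P) 0 := by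
    have h1 : HasDerivAt (fun t : ℝ => Real.log (1 + t)) 1 0 := by
      simpa using ((hasDerivAt_id (0 : ℝ)).const_add 1).log (by simp)
    have h2 := (hasDerivAt_mgf (hX.zero_mem_interior_integrableExpSet hf)).log (by simp)
    exact ((h1.const_mul (n : ℝ)).add h2).congr_deriv (by simp)
  have h0 : (0 : ℝ) ∈ Set.Ioo (-1 : ℝ) 1 := by norm_num
  rcases lt_trichotomy t 0 with h | rfl | h
  · have hs := hc.le_slope_of_hasDerivAt ht h0 h hd
    rw [slope_def_field, le_div_iff₀ (by linarith)] at hs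
    simp only [add_zero, Real.log_one, mul_zero, mgf_zero] at hs
    linarith
  · simp
  · have hs := hc.slope_le_of_hasDerivAt h0 ht h hd
    rw [slope_def_field, div_le_iff₀ (by linarith)] at hs
    simp only [add_zero, Real.log_one, mul_zero, mgf_zero] at hs
    linarith

theorem integrable_exp_mul_log_sub (hX : HasLebesgueDensity P X f) (hf : LogConcave f) {t : ℝ}
    (ht : t ∈ Set.Ioo (-1) 1) (m : ℝ) :
    Integrable (fun ω => Real.exp (t * (Real.log (f (X ω)) - m))) P := by
  have h : Integrable (fun ω => Real.exp (t * Real.log (f (X ω)))) P :=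
    hX.Ioo_subset_integrableExpSet hf ht
  refine (h.const_mul (Real.exp (-(t * m)))).congr (.of_forall fun ω => ?_)
  simp only [← Real.exp_add]
  ring_nf

theorem integral_exp_mul_log_sub_le (hX : HasLebesgueDensity P X f) (hf : LogConcave f) {t : ℝ}
    (ht : |t| ≤ 1 / 4) :
    ∫ ω, Real.exp (t * (Real.log (f (X ω)) - ∫ ω', Real.log (f (X ω')) ∂P)) ∂P ≤
      Real.exp (4 * (n * t ^ 2)) := by
  obtain ⟨hl, hr⟩ := abs_le.1 ht
  have htI : t ∈ Set.Ioo (-1 : ℝ) 1 := ⟨by linarith, by linarith⟩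
  set m := ∫ ω', Real.log (f (X ω')) ∂P with hm
  have hpos : 0 < mgf (fun ω => Real.log (f (X ω))) P t :=
    mgf_pos (hX.Ioo_subset_integrableExpSet hf htI)
  -- From exp(-(t - 4t²)) ≥ 1 - t + 4t² and (1 + t)(1 - t + 4t²) = 1 + t²(3 + 4t) ≥ 1.
  have hexp : Real.exp (t - 4 * t ^ 2) ≤ 1 + t := by
    have h1 : 1 - t + 4 * t ^ 2 ≤ Real.exp (-(t - 4 * t ^ 2)) := by
      linarith [Real.add_one_le_exp (-(t - 4 * t ^ 2))]
    have h2 : 0 < 1 - t + 4 * t ^ 2 := by nlinarith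
    rw [← neg_neg (t - 4 * t ^ 2), Real.exp_neg]
    refine (inv_anti₀ h2 h1).trans ((inv_le_iff_one_le_mul₀ h2).2 ?_)
    nlinarith [mul_nonneg (sq_nonneg t) (by linarith : 0 ≤ 3 + 4 * t)]
  have hlog : t - 4 * t ^ 2 ≤ Real.log (1 + t) :=
    (Real.le_log_iff_exp_le (by linarith)).2 hexp
  have heq : ∫ ω, Real.exp (t * (Real.log (f (X ω)) - m)) ∂P =
      Real.exp (-(t * m)) * mgf (fun ω => Real.log (f (X ω))) P t := by
    rw [mgf, ← integral_const_mul]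
    congr with ω
    rw [← Real.exp_add]
    ring_nf
  rw [heq, ← Real.exp_log hpos, ← Real.exp_add, Real.exp_le_exp]
  have h1 := hX.log_mgf_le hf htI
  have h2 := mul_le_mul_of_nonneg_left hlog (Nat.cast_nonneg (α := ℝ) n)
  linarith

end HasLebesgueDensity

/-! ### The two-sided bound -/

theorem theorem7p1 {Ω : Type*} [MeasurableSpace Ω] (P : Measure Ω) [IsProbabilityMeasure P]
    (n : ℕ) (hn : 1 ≤ n)
    (X : Ω → EuclideanSpace ℝ (Fin n)) (f : EuclideanSpace ℝ (Fin n) → ℝ)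
    (hX : HasLebesgueDensity P X f) (hf : LogConcave f) :
    Integrable (fun ω => Real.log (f (X ω))) P ∧
    ∀ α : ℝ, 0 ≤ α → α ≤ Real.sqrt n / 4 →
      Integrable (fun ω => Real.exp (α / Real.sqrt n *
        |Real.log (f (X ω)) - ∫ ω', Real.log (f (X ω')) ∂P|)) P ∧
      ∫ ω, Real.exp (α / Real.sqrt n *
        |Real.log (f (X ω)) - ∫ ω', Real.log (f (X ω')) ∂P|) ∂P
        ≤ 3 * Real.exp (4 * α ^ 2) := by
  refine ⟨hX.integrable_log hf, fun α hα0 hα => ?_⟩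
  have hn0 : (0 : ℝ) < n := by exact_mod_cast hn
  have hsqrt : 0 < Real.sqrt n := Real.sqrt_pos.2 hn0
  set m := ∫ ω', Real.log (f (X ω')) ∂P with hm
  set t := α / Real.sqrt n with ht
  have ht0 : 0 ≤ t := by positivity
  have ht4 : t ≤ 1 / 4 := by
    rw [ht, div_le_iff₀ hsqrt]
    linarith
  have htn : n * t ^ 2 = α ^ 2 := by
    rw [ht, div_pow, Real.sq_sqrt hn0.le, mul_div_cancel₀ _ hn0.ne']
  have hi1 := hX.integrable_exp_mul_log_sub hf (t := t) ⟨by linarith, by linarith⟩ m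
  have hi2 := hX.integrable_exp_mul_log_sub hf (t := -t) ⟨by linarith, by linarith⟩ m
  have hb1 := hX.integral_exp_mul_log_sub_le hf (t := t) (abs_le.2 ⟨by linarith, ht4⟩)
  have hb2 := hX.integral_exp_mul_log_sub_le hf (t := -t) (abs_le.2 ⟨by linarith, by linarith⟩)
  rw [neg_sq, htn] at hb2
  rw [htn] at hb1
  have hle : ∀ y : ℝ, Real.exp (t * |y|) ≤ Real.exp (t * y) + Real.exp (-t * y) := by
    intro y
    rcases abs_choice y with h | h <;> rw [h]
    · linarith [Real.exp_pos (-t * y)]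
    · rw [mul_neg, ← neg_mul]
      linarith [Real.exp_pos (t * y)]
  have hint : Integrable (fun ω => Real.exp (t * |Real.log (f (X ω)) - m|)) P := by
    refine (hi1.add hi2).mono'
      (((hX.aemeasurable_log_comp.sub_const m).abs.const_mul t).exp.aestronglyMeasurable)
      (.of_forall fun ω => ?_)
    rw [Real.norm_of_nonneg (Real.exp_pos _).le]
    exact hle _
  refine ⟨hint, ?_⟩
  calc ∫ ω, Real.exp (t * |Real.log (f (X ω)) - m|) ∂P
      ≤ ∫ ω, (Real.exp (t * (Real.log (f (X ω)) - m)) +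
          Real.exp (-t * (Real.log (f (X ω)) - m))) ∂P :=
        integral_mono hint (hi1.add hi2) fun ω => hle _
    _ = _ := integral_add hi1 hi2
    -- The two one-sided bounds already give the constant 2.
    _ ≤ 3 * Real.exp (4 * α ^ 2) := by linarith [Real.exp_pos (4 * α ^ 2)]
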